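/- Let $\mathcal C$ be a small category and let $R\colon \mathcal C\to \mathrm{Ring}$ be a functor to the category of unital associative (not necessarily commutative) rings (a *strict representation* of $\mathcal C$); write $R_c$ for the value at an object $c$ and $R_\alpha\colon R_c\to R_d$ for the ring homomorphism attached to $\alpha\colon c\to d$. For such $\alpha$ let $\alpha^*\colon \mathrm{Mod}\text{-}R_d\to\mathrm{Mod}\text{-}R_c$ be restriction of scalars along $R_\alpha$ and $\alpha_!=-\otimes_{R_c}R_d$ its left adjoint. A right $R$-module $M$ consists of right $R_c$-modules $M_c$ ($c\in\mathrm{Ob}\,\mathcal C$) and $R_c$-linear maps $M_\alpha\colon M_c\to\alpha^*M_d$ ($\alpha\colon c\to d$) with $M_{\beta\alpha}=\alpha^*(M_\beta)\circ M_\alpha$ and $M_{\mathrm{id}_c}=\mathrm{id}_{M_c}$; morphisms are families of $R_c$-linear maps compatible with the $M_\alpha$. The resulting category is $\mathrm{Mod}\text{-}R$. A short exact sequence $0\to N\to M\to M/N\to 0$ in $\mathrm{Mod}\text{-}R$ is *pure-exact* if for every $c$ the sequence $0\to N_c\to M_c\to M_c/N_c\to0$ is pure-exact in $\mathrm{Mod}\text{-}R_c$,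 i.e. it is short exact and $N_c\otimes_{R_c}K\to M_c\otimes_{R_c}K$ is injective for every left $R_c$-module $K$. Let $\mathrm{mod}\text{-}R_c$ be the category of finitely presented right $R_c$-modules. The pseudofunctor $R_{fp}$ from $\mathcal C$ to preadditive categories is given by $R_{fp}(c)=\mathrm{mod}\text{-}R_c$ and $R_{fp}(\alpha)=\alpha_!|_{\mathrm{mod}\text{-}R_c}$, with structural isomorphisms $\mu_{\beta,\alpha}\colon (F\otimes_{R_c}R_d)\otimes_{R_d}R_e\to F\otimes_{R_c}R_e$, $(f\otimes r_1)\otimes r_2\mapsto f\otimes R_\beta(r_1)r_2$, and $\delta_c\colon F\to F\otimes_{R_c}R_c$, $f\mapsto f\otimes1$. A right $R_{fp}$-module $\mathcal M$ consists of additive functors $\mathcal M_c\colon(\mathrm{mod}\text{-}R_c)^{op}\to\mathrm{Ab}$ and natural transformations $\mathcal M_\alpha\colon\mathcal M_c\to\mathcal M_d\circ R_{fp}(\alpha)$ such that, for all $c\xrightarrow{\alpha}d\xrightarrow{\beta}e$ and all $F\in\mathrm{mod}\text{-}R_c$, $\mathcal M_e((\mu_{\beta,\alpha})_F)\circ(\mathcal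 M_{\beta\alpha})_F=(\mathcal M_\beta)_{\alpha_!F}\circ(\mathcal M_\alpha)_F$ and $\mathcal M_c((\delta_c)_F)\circ(\mathcal M_{\mathrm{id}_c})_F=\mathrm{id}$; morphisms are families of natural transformations $\mathcal M_c\to\mathcal N_c$ compatible with the $\mathcal M_\alpha,\mathcal N_\alpha$. The resulting category is $\mathrm{Mod}\text{-}R_{fp}$. The Yoneda functor $Y\colon\mathrm{Mod}\text{-}R\to\mathrm{Mod}\text{-}R_{fp}$ is given by $Y(M)_c=\mathrm{Hom}_{R_c}(-,M_c)|_{\mathrm{mod}\text{-}R_c}$, where $Y(M)_\alpha$ sends $f\colon F\to M_c$ to the adjoint $\alpha_!F\to M_d$, $x\otimes s\mapsto M_\alpha(f(x))\,s$, of $M_\alpha\circ f$, and $Y(\phi)_c=\mathrm{Hom}_{R_c}(-,\phi_c)$. **Corollary.** A short exact sequence $0\to N\to M\to M/N\to0$ in $\mathrm{Mod}\text{-}R$ is pure-exact if and only if $0\to Y(N)\to Y(M)\to Y(M/N)\to0$ is exact in $\mathrm{Mod}\text{-}R_{fp}$. -/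

import Mathlib

open CategoryTheory MulOpposite
open scoped TensorProduct

universe w t v₁ u₁ u

namespace RepMod

/-! ### Tensor product over a noncommutative ring

Right modules over a ring `R` are modules over `Rᵐᵒᵖ`; thus `op r • x` is `x · r`. -/

section Tensor

/-- The subgroup of `M ⊗[ℤ] K` generated by the elements `(x · r) ⊗ k - x ⊗ (r · k)`. -/
def tensorRel (R : Type*) [Ring R] (M : Type*) [AddCommGroup M] [Module Rᵐᵒᵖ M]
    (K : Type*) [AddCommGroup K] [Module R K] : AddSubgroup (M ⊗[ℤ] K) :=
  AddSubgroup.closure {z | ∃ (x : M) (r : R) (k : K), z = (op r • x) ⊗ₜ[ℤ] k - x ⊗ₜ[ℤ] (r • k)}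

/-- The abelian group `M ⊗_R K` for a right `R`-module `M` and a left `R`-module `K`. -/
def BalTensor (R : Type*) [Ring R] (M : Type*) [AddCommGroup M] [Module Rᵐᵒᵖ M]
    (K : Type*) [AddCommGroup K] [Module R K] : Type _ :=
  (M ⊗[ℤ] K) ⧸ tensorRel R M K

namespace BalTensor

variable (R : Type*) [Ring R] {M : Type*} [AddCommGroup M] [Module Rᵐᵒᵖ M]
  {M' : Type*} [AddCommGroup M'] [Module Rᵐᵒᵖ M']
  {M'' : Type*} [AddCommGroup M''] [Module Rᵐᵒᵖ M'']
  {K : Type*} [AddCommGroup K] [Module R K] {A : Type*} [AddCommGroup A]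

instance : AddCommGroup (BalTensor R M K) :=
  inferInstanceAs (AddCommGroup ((M ⊗[ℤ] K) ⧸ tensorRel R M K))

/-- The pure tensor `x ⊗ k`. -/
def tmul (x : M) (k : K) : BalTensor R M K := QuotientAddGroup.mk' (tensorRel R M K) (x ⊗ₜ[ℤ] k)

theorem add_tmul (x y : M) (k : K) : tmul R (x + y) k = tmul R x k + tmul R y k := by
  simp only [tmul, TensorProduct.add_tmul, map_add]; rfl

theorem tmul_add (x : M) (k l : K) : tmul R x (k + l) = tmul R x k + tmul R x l := by
  simp only [tmul, TensorProduct.tmul_add, map_add]; rfl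

theorem smul_tmul (x : M) (r : R) (k : K) : tmul R (op r • x) k = tmul R x (r • k) := by
  have h : (op r • x) ⊗ₜ[ℤ] k - x ⊗ₜ[ℤ] (r • k) ∈ tensorRel R M K :=
    AddSubgroup.subset_closure ⟨x, r, k, rfl⟩
  have h2 := (QuotientAddGroup.eq_zero_iff _).2 h
  exact sub_eq_zero.1 h2

variable {R}

theorem hom_ext {f g : BalTensor R M K →+ A}
    (h : ∀ (x : M) (k : K), f (tmul R x k) = g (tmul R x k)) : f = g := by
  refine QuotientAddGroup.addMonoidHom_ext _ ?_
  have key : ∀ z : M ⊗[ℤ] K, (f.comp (QuotientAddGroup.mk' (tensorRel R M K))) z =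
      (g.comp (QuotientAddGroup.mk' (tensorRel R M K))) z := by
    intro z
    induction z using TensorProduct.induction_on with
    | zero => rw [map_zero, map_zero]
    | tmul x k => exact h x k
    | add a b ha hb => rw [map_add, map_add, ha, hb]
  exact DFunLike.ext _ _ key

/-- A balanced biadditive map induces a homomorphism on `M ⊗_R K`. -/
def lift (f : M →+ K →+ A) (hf : ∀ (x : M) (r : R) (k : K), f (op r • x) k = f x (r • k)) :
    BalTensor R M K →+ A :=
  QuotientAddGroup.lift (tensorRel R M K)
    (TensorProduct.liftAddHom f (fun n x k => by simp)) <| by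
      rw [tensorRel, AddSubgroup.closure_le]
      rintro _ ⟨x, r, k, rfl⟩
      simp [hf, AddMonoidHom.mem_ker]

@[simp]
theorem lift_tmul (f : M →+ K →+ A)
    (hf : ∀ (x : M) (r : R) (k : K), f (op r • x) k = f x (r • k)) (x : M) (k : K) :
    lift f hf (tmul R x k) = f x k := rfl

/-- The homomorphism `f ⊗ id_K` induced by a homomorphism `f` of right `R`-modules. -/
def map (K : Type*) [AddCommGroup K] [Module R K] (f : M →ₗ[Rᵐᵒᵖ] M') :
    BalTensor R M K →+ BalTensor R M' K :=
  lift (AddMonoidHom.mk' (fun x => AddMonoidHom.mk' (fun k => tmul R (f x) k)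
      (fun k l => tmul_add R _ k l))
    (fun x y => by ext k; simp [add_tmul]))
    (fun x r k => by simp [smul_tmul])

@[simp]
theorem map_tmul (f : M →ₗ[Rᵐᵒᵖ] M') (x : M) (k : K) :
    map K f (tmul R x k) = tmul R (f x) k := rfl

section RightAction

variable {S : Type*} [Ring S] [Module Sᵐᵒᵖ K] [SMulCommClass R Sᵐᵒᵖ K]

/-- The endomorphism `x ⊗ k ↦ x ⊗ (k · s)`. -/
def rightMul (s : Sᵐᵒᵖ) : BalTensor R M K →+ BalTensor R M K :=
  lift (AddMonoidHom.mk' (fun x => AddMonoidHom.mk' (fun k => tmul R x (s • k))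
      (fun k l => by rw [smul_add, tmul_add]))
    (fun x y => by ext k; simp [add_tmul]))
    (fun x r k => by simp [smul_tmul, smul_comm r s k])

/-- If `K` is a (left `R`)-(right `S`)-bimodule, then `M ⊗_R K` is a right `S`-module,
with `(x ⊗ k) · s = x ⊗ (k · s)`. -/
instance : Module Sᵐᵒᵖ (BalTensor R M K) where
  smul s z := rightMul s z
  one_smul z := by
    change rightMul (1 : Sᵐᵒᵖ) z = AddMonoidHom.id _ z
    congr 1
    exact hom_ext fun x k => by simp [rightMul]
  mul_smul s s' z := by
    change rightMul (s * s') z = ((rightMul s).comp (rightMul s')) z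
    congr 1
    exact hom_ext fun x k => by simp [rightMul, mul_smul]
  smul_zero s := map_zero (rightMul s)
  smul_add s := map_add (rightMul s)
  add_smul s s' z := by
    change rightMul (s + s') z = (rightMul s + rightMul s' : BalTensor R M K →+ BalTensor R M K) z
    congr 1
    exact hom_ext fun x k => by simp [rightMul, add_smul, tmul_add]
  zero_smul z := by
    change rightMul (0 : Sᵐᵒᵖ) z = (0 : BalTensor R M K →+ BalTensor R M K) z
    congr 1
    refine hom_ext fun x k => ?_
    have h := tmul_add R x (0 : K) 0
    simp only [add_zero] at h
    simpa [rightMul] using h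

@[simp]
theorem smul_tmul' (s : Sᵐᵒᵖ) (x : M) (k : K) : s • tmul R x k = tmul R x (s • k) := rfl

end RightAction

end BalTensor

end Tensor

/-! ### Extension of scalars -/

section Extension

/-- For a ring homomorphism `φ : R → S`, the ring `S` as a (left `R`)-(right `S`)-bimodule,
with `r · s = φ r * s`. -/
def RestrLeft {R S : Type*} [Ring R] [Ring S] (_φ : R →+* S) : Type _ := S

variable {R S T : Type u} [Ring R] [Ring S] [Ring T]

instance (φ : R →+* S) : AddCommGroup (RestrLeft φ) := inferInstanceAs (AddCommGroup S)
instance (φ : R →+* S) : Module R (RestrLeft φ) := Module.compHom S φ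
instance (φ : R →+* S) : Module Sᵐᵒᵖ (RestrLeft φ) := inferInstanceAs (Module Sᵐᵒᵖ S)

/-- An element of `S` as an element of the bimodule. -/
def RestrLeft.of (φ : R →+* S) (s : S) : RestrLeft φ := s

/-- The underlying element of `S`. -/
def RestrLeft.val {φ : R →+* S} (k : RestrLeft φ) : S := k

@[simp]
theorem RestrLeft.smul_of (φ : R →+* S) (r : R) (s : S) : r • of φ s = of φ (φ r * s) := rfl

@[simp]
theorem RestrLeft.op_smul_of (φ : R →+* S) (s' : Sᵐᵒᵖ) (s : S) :
    s' • of φ s = of φ (s * s'.unop) := rfl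

instance (φ : R →+* S) : SMulCommClass R Sᵐᵒᵖ (RestrLeft φ) where
  smul_comm r s k := (mul_assoc (φ r) k.val s.unop).symm

/-- The right `S`-module `φ_! M = M ⊗_R S`. -/
abbrev Ext (φ : R →+* S) (M : Type*) [AddCommGroup M] [Module Rᵐᵒᵖ M] : Type _ :=
  BalTensor R M (RestrLeft φ)

variable {M N : Type*} [AddCommGroup M] [Module Rᵐᵒᵖ M] [AddCommGroup N] [Module Rᵐᵒᵖ N]
  {L : Type*} [AddCommGroup L] [Module Sᵐᵒᵖ L]

/-- The element `x ⊗ s` of `φ_! M = M ⊗_R S`. -/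
def Ext.mk (φ : R →+* S) (x : M) (s : S) : Ext φ M := BalTensor.tmul R x (RestrLeft.of φ s)

theorem Ext.add_mk (φ : R →+* S) (x y : M) (s : S) :
    Ext.mk φ (x + y) s = Ext.mk φ x s + Ext.mk φ y s := BalTensor.add_tmul R _ _ _

theorem Ext.mk_add (φ : R →+* S) (x : M) (s s' : S) :
    Ext.mk φ x (s + s') = Ext.mk φ x s + Ext.mk φ x s' := BalTensor.tmul_add R _ _ _

theorem Ext.smul_mk (φ : R →+* S) (x : M) (r : Rᵐᵒᵖ) (s : S) :
    Ext.mk φ (r • x) s = Ext.mk φ x (φ r.unop * s) := BalTensor.smul_tmul R x r.unop _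

@[simp]
theorem Ext.op_smul_mk (φ : R →+* S) (x : M) (s : S) (s' : Sᵐᵒᵖ) :
    s' • Ext.mk φ x s = Ext.mk φ x (s * s'.unop) := rfl

theorem Ext.hom_ext {φ : R →+* S} {τ : Sᵐᵒᵖ →+* Tᵐᵒᵖ} {L : Type*} [AddCommGroup L]
    [Module Tᵐᵒᵖ L] {f g : Ext φ M →ₛₗ[τ] L}
    (h : ∀ x : M, f (Ext.mk φ x 1) = g (Ext.mk φ x 1)) : f = g := by
  have : f.toAddMonoidHom = g.toAddMonoidHom := by
    refine BalTensor.hom_ext fun x k => ?_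
    have e : BalTensor.tmul R x k = op k.val • Ext.mk φ x 1 := by
      rw [Ext.op_smul_mk, one_mul]; rfl
    change f _ = g _
    rw [e, map_smulₛₗ, map_smulₛₗ, h]
  ext z
  exact DFunLike.congr_fun this z

/-- The `S`-linear map `M ⊗_R S → L`, `x ⊗ s ↦ g x · s`, adjoint to an `R`-linear map
`g : M → φ^* L` (that is, to a map `g` that is semilinear along `φ`). -/
def Ext.lift (φ : R →+* S) (g : M →ₛₗ[RingHom.op φ] L) : Ext φ M →ₗ[Sᵐᵒᵖ] L :=
  let f : Ext φ M →+ L := BalTensor.lift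
    (AddMonoidHom.mk' (fun x => AddMonoidHom.mk' (fun k : RestrLeft φ => op k.val • g x)
        (fun k l => add_smul (op k.val) (op l.val) (g x)))
      (fun x y => by ext k; simp; rfl))
    (fun x r k => by
      change op k.val • g (op r • x) = op (φ r * k.val) • g x
      rw [map_smulₛₗ, op_mul, mul_smul]; rfl)
  { f with
    map_smul' := fun s z => by
      change (f.comp (DistribSMul.toAddMonoidHom _ s)) z =
        ((DistribSMul.toAddMonoidHom L s).comp f) z
      congr 1
      refine BalTensor.hom_ext fun x k => ?_
      change op (k.val * s.unop) • g x = s • op k.val • g x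
      rw [op_mul, mul_smul]; rfl }

@[simp]
theorem Ext.lift_mk (φ : R →+* S) (g : M →ₛₗ[RingHom.op φ] L) (x : M) (s : S) :
    Ext.lift φ g (Ext.mk φ x s) = op s • g x := rfl

/-- The map `φ_! f = f ⊗ id_S`. -/
def Ext.map (φ : R →+* S) (f : M →ₗ[Rᵐᵒᵖ] N) : Ext φ M →ₗ[Sᵐᵒᵖ] Ext φ N where
  __ := BalTensor.map (RestrLeft φ) f
  map_smul' s z := by
    change ((BalTensor.map (RestrLeft φ) f).comp (DistribSMul.toAddMonoidHom _ s)) z =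
      ((DistribSMul.toAddMonoidHom _ s).comp (BalTensor.map (RestrLeft φ) f)) z
    congr 1
    exact BalTensor.hom_ext fun x k => rfl

@[simp]
theorem Ext.map_mk (φ : R →+* S) (f : M →ₗ[Rᵐᵒᵖ] N) (x : M) (s : S) :
    Ext.map φ f (Ext.mk φ x s) = Ext.mk φ (f x) s := rfl

/-- The unit `x ↦ x ⊗ 1` of the change of base adjunction. -/
def Ext.unit (φ : R →+* S) (M : Type*) [AddCommGroup M] [Module Rᵐᵒᵖ M] :
    M →ₛₗ[RingHom.op φ] Ext φ M where
  toFun x := Ext.mk φ x 1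
  map_add' x y := Ext.add_mk φ x y 1
  map_smul' r x := by
    rw [Ext.smul_mk]; simp

/-- The map `M ⊗_R S → M ⊗_R T`, `x ⊗ s ↦ x ⊗ ψ s`, where `χ = ψ ∘ φ`. -/
def Ext.mapRing (φ : R →+* S) (ψ : S →+* T) (χ : R →+* T) (hχ : ψ.comp φ = χ)
    (M : Type*) [AddCommGroup M] [Module Rᵐᵒᵖ M] : Ext φ M →ₛₗ[RingHom.op ψ] Ext χ M :=
  let f : Ext φ M →+ Ext χ M := BalTensor.lift
    (AddMonoidHom.mk' (fun x => AddMonoidHom.mk' (fun k : RestrLeft φ => Ext.mk χ x (ψ k.val))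
        (fun k l => (congrArg (Ext.mk χ x) (map_add ψ k.val l.val)).trans (Ext.mk_add χ x _ _)))
      (fun x y => by ext k; exact Ext.add_mk χ x y _))
    (fun x r k => by
      subst hχ
      change Ext.mk _ (op r • x) (ψ k.val) = Ext.mk _ x (ψ (φ r * k.val))
      rw [Ext.smul_mk, map_mul]; rfl)
  { f with
    map_smul' := fun s z => by
      change (f.comp (DistribSMul.toAddMonoidHom _ s)) z =
        ((DistribSMul.toAddMonoidHom (Ext χ M) (RingHom.op ψ s)).comp f) z
      congr 1
      refine BalTensor.hom_ext fun x k => ?_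
      change Ext.mk χ x (ψ (k.val * s.unop)) = Ext.mk χ x (ψ k.val * ψ s.unop)
      rw [map_mul] }

@[simp]
theorem Ext.mapRing_mk (φ : R →+* S) (ψ : S →+* T) (χ : R →+* T) (hχ : ψ.comp φ = χ)
    (x : M) (s : S) : Ext.mapRing φ ψ χ hχ M (Ext.mk φ x s) = Ext.mk χ x (ψ s) := rfl

/-- The isomorphism `(M ⊗_R S) ⊗_S T ≃ M ⊗_R T`, `(x ⊗ s) ⊗ t ↦ x ⊗ ψ s * t`, for
`χ = ψ ∘ φ`; its inverse is `x ⊗ t ↦ (x ⊗ 1) ⊗ t`. -/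
def Ext.compEquiv (φ : R →+* S) (ψ : S →+* T) (χ : R →+* T) (hχ : ψ.comp φ = χ)
    (M : Type*) [AddCommGroup M] [Module Rᵐᵒᵖ M] : Ext ψ (Ext φ M) ≃ₗ[Tᵐᵒᵖ] Ext χ M :=
  LinearEquiv.ofLinearMap (Ext.lift ψ (Ext.mapRing φ ψ χ hχ M))
    (Ext.lift χ
      { toFun := fun x => Ext.mk ψ (Ext.mk φ x 1) 1
        map_add' := fun f g => by rw [Ext.add_mk, Ext.add_mk]
        map_smul' := fun r x => by
          subst hχ
          have e : Ext.mk φ x (φ r.unop) = op (φ r.unop) • Ext.mk φ x 1 := by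
            rw [Ext.op_smul_mk, one_mul]; rfl
          rw [Ext.smul_mk, mul_one, e, Ext.smul_mk, mul_one]
          exact congrArg (Ext.mk ψ _) (one_mul _).symm })
    (Ext.hom_ext fun x => by
      change Ext.mk χ x (ψ 1 * (1 * 1)) = Ext.mk χ x 1
      rw [map_one, one_mul, one_mul])
    (Ext.hom_ext fun z => by
      refine DFunLike.congr_fun (f := ((Ext.lift χ _).comp
        ((Ext.lift ψ (Ext.mapRing φ ψ χ hχ M)))).comp (Ext.unit ψ _))
        (g := Ext.unit ψ _) (Ext.hom_ext fun x => ?_) z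
      change Ext.mk ψ (Ext.mk φ x 1) (1 * (ψ 1 * 1)) = Ext.mk ψ (Ext.mk φ x 1) 1
      rw [map_one, one_mul, one_mul])

@[simp]
theorem Ext.compEquiv_mk (φ : R →+* S) (ψ : S →+* T) (χ : R →+* T) (hχ : ψ.comp φ = χ)
    (x : M) (s : S) (t : T) :
    Ext.compEquiv φ ψ χ hχ M (Ext.mk ψ (Ext.mk φ x s) t) = Ext.mk χ x (ψ s * t) := rfl

/-- Two linear maps on `(M ⊗_R S) ⊗_S T` agree if they agree on the elements `(x ⊗ 1) ⊗ 1`. -/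
theorem Ext.hom_ext₂ {φ : R →+* S} {ψ : S →+* T} {L : Type*} [AddCommGroup L]
    [Module Tᵐᵒᵖ L] {f g : Ext ψ (Ext φ M) →ₗ[Tᵐᵒᵖ] L}
    (h : ∀ x : M, f (Ext.mk ψ (Ext.mk φ x 1) 1) = g (Ext.mk ψ (Ext.mk φ x 1) 1)) : f = g :=
  Ext.hom_ext fun z => DFunLike.congr_fun (f := f.comp (Ext.unit ψ _)) (g := g.comp (Ext.unit ψ _))
    (Ext.hom_ext h) z

/-- Associativity of the isomorphisms `Ext.compEquiv`. -/
theorem Ext.compEquiv_assoc {U : Type u} [Ring U] (φ : R →+* S) (ψ : S →+* T) (θ : T →+* U)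
    (χ₁ : R →+* T) (χ₂ : S →+* U) (χ : R →+* U) (h₁ : ψ.comp φ = χ₁) (h₂ : θ.comp ψ = χ₂)
    (h₃ : θ.comp χ₁ = χ) (h₄ : χ₂.comp φ = χ) (z : Ext θ (Ext ψ (Ext φ M))) :
    Ext.compEquiv χ₁ θ χ h₃ M (Ext.map θ (Ext.compEquiv φ ψ χ₁ h₁ M).toLinearMap z) =
      Ext.compEquiv φ χ₂ χ h₄ M (Ext.compEquiv ψ θ χ₂ h₂ (Ext φ M) z) := by
  let f := (Ext.compEquiv χ₁ θ χ h₃ M).toLinearMap.comp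
    (Ext.map θ (Ext.compEquiv φ ψ χ₁ h₁ M).toLinearMap)
  let g := (Ext.compEquiv φ χ₂ χ h₄ M).toLinearMap.comp
    (Ext.compEquiv ψ θ χ₂ h₂ (Ext φ M)).toLinearMap
  have : RingHomCompTriple (RingHom.op ψ) (RingHom.op θ) (RingHom.op χ₂) :=
    ⟨by subst h₂; rfl⟩
  have key : f = g := by
    refine Ext.hom_ext₂ fun y => ?_
    have key₂ : (f.comp (Ext.unit θ _)).comp (Ext.unit ψ (Ext φ M)) =
        (g.comp (Ext.unit θ _)).comp (Ext.unit ψ (Ext φ M)) := by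
      refine Ext.hom_ext fun x => ?_
      change Ext.mk χ x (θ (ψ 1 * 1) * 1) = Ext.mk χ x (χ₂ 1 * (θ 1 * 1))
      simp
    exact DFunLike.congr_fun key₂ y
  exact DFunLike.congr_fun key z

/-- The isomorphism `M ≃ M ⊗_R R`, `x ↦ x ⊗ 1`, along `φ = id`. -/
def Ext.idEquiv (φ : R →+* R) (hφ : φ = RingHom.id R) (M : Type*) [AddCommGroup M]
    [Module Rᵐᵒᵖ M] : M ≃ₗ[Rᵐᵒᵖ] Ext φ M :=
  LinearEquiv.ofLinearMap
    { toFun := fun x => Ext.mk φ x 1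
      map_add' := fun x y => Ext.add_mk φ x y 1
      map_smul' := fun r x => by
        subst hφ
        rw [Ext.smul_mk]
        simp }
    (Ext.lift φ
      { toFun := fun x => x
        map_add' := fun x y => rfl
        map_smul' := fun r x => by subst hφ; rfl })
    (Ext.hom_ext fun x => by
      change Ext.mk φ ((1 : Rᵐᵒᵖ) • x) 1 = Ext.mk φ x 1
      rw [one_smul])
    (LinearMap.ext fun x => one_smul _ x)

@[simp]
theorem Ext.idEquiv_apply (φ : R →+* R) (hφ : φ = RingHom.id R) (x : M) :
    Ext.idEquiv φ hφ M x = Ext.mk φ x 1 := rfl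

/-- The map `φⁿ : Rⁿ → Sⁿ`. -/
def piMap (φ : R →+* S) (n : ℕ) : (Fin n → Rᵐᵒᵖ) →ₛₗ[RingHom.op φ] (Fin n → Sᵐᵒᵖ) where
  toFun y i := RingHom.op φ (y i)
  map_add' x y := by ext i; simp
  map_smul' r x := by ext i; simp

/-- Extension of scalars preserves finite presentation. -/
theorem Ext.finitePresentation (φ : R →+* S) [Module.FinitePresentation Rᵐᵒᵖ M] :
    Module.FinitePresentation Sᵐᵒᵖ (Ext φ M) := by
  classical
  obtain ⟨n, m, f, g, hf, hfg⟩ := Module.FinitePresentation.exists_fin' Rᵐᵒᵖ M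
  let l : (Fin n → Sᵐᵒᵖ) →ₗ[Sᵐᵒᵖ] Ext φ M :=
    Fintype.linearCombination Sᵐᵒᵖ (fun i => Ext.mk φ (f (Pi.single i 1)) 1)
  have hl : ∀ y : Fin n → Rᵐᵒᵖ, l (piMap φ n y) = Ext.unit φ M (f y) := by
    intro y
    have hy : y = ∑ i, y i • (Pi.single i 1 : Fin n → Rᵐᵒᵖ) := pi_eq_sum_univ' y
    conv_rhs => rw [hy]
    rw [map_sum, map_sum, Fintype.linearCombination_apply]
    refine Finset.sum_congr rfl fun i _ => ?_
    rw [map_smul, map_smulₛₗ]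
    rfl
  let N : Submodule Sᵐᵒᵖ (Fin n → Sᵐᵒᵖ) :=
    Submodule.span Sᵐᵒᵖ (Set.range fun j : Fin m => piMap φ n (g (Pi.single j 1)))
  have hN : ∀ y, f y = 0 → piMap φ n y ∈ N := by
    intro y hy
    obtain ⟨z, rfl⟩ := (hfg y).1 hy
    have hz : z = ∑ j, z j • (Pi.single j 1 : Fin m → Rᵐᵒᵖ) := pi_eq_sum_univ' z
    rw [hz, map_sum, map_sum]
    refine Submodule.sum_mem _ fun j _ => ?_
    rw [map_smul, map_smulₛₗ]
    exact Submodule.smul_mem _ _ (Submodule.subset_span ⟨j, rfl⟩)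
  have hwd : ∀ y y', f y = f y' → N.mkQ (piMap φ n y) = N.mkQ (piMap φ n y') := by
    intro y y' h
    rw [← sub_eq_zero, ← map_sub, ← map_sub, Submodule.mkQ_apply, Submodule.Quotient.mk_eq_zero]
    exact hN _ (by rw [map_sub, h, sub_self])
  let q : M →ₛₗ[RingHom.op φ] ((Fin n → Sᵐᵒᵖ) ⧸ N) :=
    { toFun := fun x => N.mkQ (piMap φ n (Function.surjInv hf x))
      map_add' := fun x y => by
        rw [← map_add, ← map_add]
        exact hwd _ _ (by simp [Function.surjInv_eq])
      map_smul' := fun r x => by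
        rw [← map_smul, ← map_smulₛₗ]
        exact hwd _ _ (by simp [Function.surjInv_eq]) }
  have hb : (Ext.lift φ q).comp l = N.mkQ := by
    refine LinearMap.pi_ext' fun i => LinearMap.ext_ring ?_
    have e : (Pi.single i 1 : Fin n → Sᵐᵒᵖ) = piMap φ n (Pi.single i 1) := by
      ext k
      by_cases hk : k = i
      · subst hk; simp [piMap]
      · simp [piMap, hk]
    change Ext.lift φ q (l (Pi.single i 1)) = N.mkQ (Pi.single i 1)
    rw [e, hl]
    change (1 : Sᵐᵒᵖ) • q (f (Pi.single i 1)) = _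
    rw [one_smul]
    exact hwd _ _ (Function.surjInv_eq hf _)
  refine Module.finitePresentation_of_surjective l ?_ ?_
  · rw [← LinearMap.range_eq_top, eq_top_iff]
    intro z _
    have key : (QuotientAddGroup.mk' (LinearMap.range l).toAddSubgroup) = 0 := by
      refine BalTensor.hom_ext fun x k => ?_
      refine (QuotientAddGroup.eq_zero_iff _).2 ?_
      obtain ⟨y, rfl⟩ := hf x
      refine ⟨op k.val • piMap φ n y, ?_⟩
      rw [map_smul, hl]
      change Ext.mk φ (f y) (1 * k.val) = Ext.mk φ (f y) k
      rw [one_mul]; rfl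
    exact (QuotientAddGroup.eq_zero_iff _).1 (DFunLike.congr_fun key z)
  · have hker : LinearMap.ker l = N := by
      apply le_antisymm
      · intro y hy
        have h := DFunLike.congr_fun hb y
        rw [LinearMap.comp_apply, LinearMap.mem_ker.1 hy, map_zero] at h
        exact (Submodule.Quotient.mk_eq_zero N).1 h.symm
      · rw [Submodule.span_le]
        rintro _ ⟨j, rfl⟩
        change l _ = 0
        rw [hl, hfg.apply_apply_eq_zero, map_zero]
    rw [hker]
    exact Submodule.fg_span (Set.finite_range _)

end Extension

/-! ### Representations of a category and their right modules -/

section Representation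

variable (C : Type u₁) [Category.{v₁} C]

/-- A representation of `C`: a pseudofunctor from `C` to preadditive categories and additive
functors. The composition isomorphism `μ α β γ h : R_β R_α ≅ R_γ` is indexed by the composite
`γ = β ∘ α` together with the equality `h`, so that no transport along equalities of
morphisms of `C` is needed. -/
structure AddRep where
  /-- the preadditive category `R_c` -/
  obj : C → Type w
  [category : ∀ c, Category.{t} (obj c)]
  [preadditive : ∀ c, Preadditive (obj c)]
  /-- the functor `R_α` -/
  map : ∀ {c d : C}, (c ⟶ d) → obj c ⥤ obj d
  [additive : ∀ {c d : C} (α : c ⟶ d), (map α).Additive]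
  δ : ∀ c : C, 𝟭 (obj c) ≅ map (𝟙 c)
  μ : ∀ {c d e : C} (α : c ⟶ d) (β : d ⟶ e) (γ : c ⟶ e), α ≫ β = γ → (map α ⋙ map β ≅ map γ)
  assoc : ∀ {c d e f : C} (α : c ⟶ d) (β : d ⟶ e) (γ : e ⟶ f) (αβ : c ⟶ e) (βγ : d ⟶ f)
    (αβγ : c ⟶ f) (h₁ : α ≫ β = αβ) (h₂ : β ≫ γ = βγ) (h₃ : αβ ≫ γ = αβγ) (h₄ : α ≫ βγ = αβγ)
    (x : obj c),
    (map γ).map ((μ α β αβ h₁).hom.app x) ≫ (μ αβ γ αβγ h₃).hom.app x =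
      (μ β γ βγ h₂).hom.app ((map α).obj x) ≫ (μ α βγ αβγ h₄).hom.app x
  unit_left : ∀ {c d : C} (α : c ⟶ d) (h : 𝟙 c ≫ α = α) (x : obj c),
    (map α).map ((δ c).hom.app x) ≫ (μ (𝟙 c) α α h).hom.app x = 𝟙 ((map α).obj x)
  unit_right : ∀ {c d : C} (α : c ⟶ d) (h : α ≫ 𝟙 d = α) (x : obj c),
    (δ d).hom.app ((map α).obj x) ≫ (μ α (𝟙 d) α h).hom.app x = 𝟙 ((map α).obj x)

attribute [instance] AddRep.category AddRep.preadditive AddRep.additive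

variable {C}

/-- A right module `M` over a representation `P`: additive functors `M_c : (P_c)ᵒᵖ → Ab` and natural
transformations `M_α : M_c → α^* M_d = M_d ∘ P_α`, compatible with the structural isomorphisms. -/
structure Mod (P : AddRep.{w, t} C) where
  obj : ∀ c : C, (P.obj c)ᵒᵖ ⥤ AddCommGrpCat.{u}
  [additive : ∀ c, (obj c).Additive]
  map : ∀ {c d : C} (α : c ⟶ d), obj c ⟶ (P.map α).op ⋙ obj d
  map_comp : ∀ {c d e : C} (α : c ⟶ d) (β : d ⟶ e) (γ : c ⟶ e) (h : α ≫ β = γ) (x : P.obj c),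
    (map γ).app (Opposite.op x) ≫ (obj e).map ((P.μ α β γ h).hom.app x).op =
      (map α).app (Opposite.op x) ≫ (map β).app (Opposite.op ((P.map α).obj x))
  map_id : ∀ (c : C) (x : P.obj c),
    (map (𝟙 c)).app (Opposite.op x) ≫ (obj c).map ((P.δ c).hom.app x).op =
      𝟙 ((obj c).obj (Opposite.op x))

attribute [instance] Mod.additive

namespace Mod

variable {P : AddRep.{w, t} C}

/-- A morphism of right modules over a representation. -/
@[ext]
structure Hom (M N : Mod.{w, t, v₁, u₁, u} P) where
  app : ∀ c : C, M.obj c ⟶ N.obj c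
  naturality : ∀ {c d : C} (α : c ⟶ d),
    M.map α ≫ Functor.whiskerLeft (P.map α).op (app d) = app c ≫ N.map α

instance : Category (Mod.{w, t, v₁, u₁, u} P) where
  Hom := Hom
  id M := ⟨fun c => 𝟙 (M.obj c), fun α => by ext; simp⟩
  comp f g := ⟨fun c => f.app c ≫ g.app c, fun {c d} α => by
    rw [Functor.whiskerLeft_comp, ← Category.assoc, f.naturality, Category.assoc, g.naturality,
      Category.assoc]⟩

@[ext]
theorem hom_ext {M N : Mod.{w, t, v₁, u₁, u} P} {f g : M ⟶ N} (h : ∀ c, f.app c = g.app c) :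
    f = g :=
  Hom.ext (funext h)

@[simp]
theorem id_app (M : Mod.{w, t, v₁, u₁, u} P) (c : C) : Hom.app (𝟙 M) c = 𝟙 (M.obj c) := rfl

@[simp]
theorem comp_app {M N L : Mod.{w, t, v₁, u₁, u} P} (f : M ⟶ N) (g : N ⟶ L) (c : C) :
    Hom.app (f ≫ g) c = f.app c ≫ g.app c := rfl

instance (M N : Mod.{w, t, v₁, u₁, u} P) : Zero (M ⟶ N) :=
  ⟨⟨fun _ => 0, fun α => by ext; simp⟩⟩

instance (M N : Mod.{w, t, v₁, u₁, u} P) : Add (M ⟶ N) :=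
  ⟨fun f g => ⟨fun c => f.app c + g.app c, fun {c d} α => by
    have hf := f.naturality α
    have hg := g.naturality α
    rw [Preadditive.add_comp, ← hf, ← hg, ← Preadditive.comp_add]
    rfl⟩⟩

instance (M N : Mod.{w, t, v₁, u₁, u} P) : Neg (M ⟶ N) :=
  ⟨fun f => ⟨fun c => - f.app c, fun {c d} α => by
    rw [Preadditive.neg_comp, ← f.naturality α, ← Preadditive.comp_neg]
    rfl⟩⟩

@[simp]
theorem zero_app (M N : Mod.{w, t, v₁, u₁, u} P) (c : C) : Hom.app (0 : M ⟶ N) c = 0 := rfl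

@[simp]
theorem add_app {M N : Mod.{w, t, v₁, u₁, u} P} (f g : M ⟶ N) (c : C) :
    Hom.app (f + g) c = f.app c + g.app c := rfl

@[simp]
theorem neg_app {M N : Mod.{w, t, v₁, u₁, u} P} (f : M ⟶ N) (c : C) :
    Hom.app (-f) c = - f.app c := rfl

instance : Preadditive (Mod.{w, t, v₁, u₁, u} P) where
  homGroup M N :=
    { add_assoc := fun f g h => hom_ext fun c => by simp [add_assoc]
      zero_add := fun f => hom_ext fun c => by simp
      add_zero := fun f => hom_ext fun c => by simp
      nsmul := nsmulRec
      zsmul := zsmulRec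
      neg_add_cancel := fun f => hom_ext fun c => by simp
      add_comm := fun f g => hom_ext fun c => by simp [add_comm] }
  add_comp _ _ _ f g h := hom_ext fun c => Preadditive.add_comp _ _ _ (f.app c) (g.app c) (h.app c)
  comp_add _ _ _ f g h := hom_ext fun c => Preadditive.comp_add _ _ _ (f.app c) (g.app c) (h.app c)

end Mod

end Representation

/-! ### Right modules over a strict representation in rings -/

section Strict

variable {C : Type u₁} [Category.{v₁} C]

/-- A right module `M` over a strict representation `R : C ⥤ Ring`: right `R_c`-modules `M_c` and
`R_c`-linear maps `M_α : M_c → α^* M_d` (that is, maps `M_c → M_d` semilinear along `R_α`),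
with `M_{β α} = α^* M_β ∘ M_α` and `M_{id} = id`. -/
structure StrictMod (R : C ⥤ RingCat.{u}) where
  obj : ∀ c : C, ModuleCat.{u} (R.obj c)ᵐᵒᵖ
  map : ∀ {c d : C} (α : c ⟶ d), obj c →ₛₗ[RingHom.op (R.map α).hom] obj d
  map_comp : ∀ {c d e : C} (α : c ⟶ d) (β : d ⟶ e) (x : obj c), map (α ≫ β) x = map β (map α x)
  map_id : ∀ (c : C) (x : obj c), map (𝟙 c) x = x

namespace StrictMod

variable {R : C ⥤ RingCat.{u}}

/-- A morphism of right modules over a strict representation. -/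
@[ext]
structure Hom (M N : StrictMod R) where
  app : ∀ c : C, M.obj c ⟶ N.obj c
  naturality : ∀ {c d : C} (α : c ⟶ d) (x : M.obj c),
    (app d).hom (M.map α x) = N.map α ((app c).hom x)

instance : Category (StrictMod R) where
  Hom := Hom
  id M := ⟨fun c => 𝟙 (M.obj c), fun α x => rfl⟩
  comp f g := ⟨fun c => f.app c ≫ g.app c, fun α x => by simp [f.naturality, g.naturality]⟩

@[ext]
theorem hom_ext {M N : StrictMod R} {f g : M ⟶ N} (h : ∀ c, f.app c = g.app c) : f = g :=
  Hom.ext (funext h)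

@[simp]
theorem id_app (M : StrictMod R) (c : C) : Hom.app (𝟙 M) c = 𝟙 (M.obj c) := rfl

@[simp]
theorem comp_app {M N L : StrictMod R} (f : M ⟶ N) (g : N ⟶ L) (c : C) :
    Hom.app (f ≫ g) c = f.app c ≫ g.app c := rfl

instance (M N : StrictMod R) : Zero (M ⟶ N) := ⟨⟨fun _ => 0, fun α x => by simp⟩⟩

instance (M N : StrictMod R) : Add (M ⟶ N) :=
  ⟨fun f g => ⟨fun c => f.app c + g.app c, fun α x => by simp [f.naturality, g.naturality]⟩⟩

instance (M N : StrictMod R) : Neg (M ⟶ N) :=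
  ⟨fun f => ⟨fun c => - f.app c, fun α x => by simp [f.naturality]⟩⟩

@[simp]
theorem zero_app (M N : StrictMod R) (c : C) : Hom.app (0 : M ⟶ N) c = 0 := rfl

@[simp]
theorem add_app {M N : StrictMod R} (f g : M ⟶ N) (c : C) :
    Hom.app (f + g) c = f.app c + g.app c := rfl

@[simp]
theorem neg_app {M N : StrictMod R} (f : M ⟶ N) (c : C) : Hom.app (-f) c = - f.app c := rfl

instance : Preadditive (StrictMod R) where
  homGroup M N :=
    { add_assoc := fun f g h => hom_ext fun c => by simp [add_assoc]
      zero_add := fun f => hom_ext fun c => by simp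
      add_zero := fun f => hom_ext fun c => by simp
      nsmul := nsmulRec
      zsmul := zsmulRec
      neg_add_cancel := fun f => hom_ext fun c => by simp
      add_comm := fun f g => hom_ext fun c => by simp [add_comm] }
  add_comp _ _ _ f g h := hom_ext fun c => Preadditive.add_comp _ _ _ (f.app c) (g.app c) (h.app c)
  comp_add _ _ _ f g h := hom_ext fun c => Preadditive.comp_add _ _ _ (f.app c) (g.app c) (h.app c)

/-- The functor `M ↦ M_c`. -/
def eval (R : C ⥤ RingCat.{u}) (c : C) : StrictMod R ⥤ ModuleCat.{u} (R.obj c)ᵐᵒᵖ where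
  obj M := M.obj c
  map f := f.app c

instance (c : C) : (eval R c).Additive where

end StrictMod

/-- A sequence `0 → N → M → L → 0` of right modules over a ring `A` is pure-exact if it is short
exact and `0 → N ⊗_A K → M ⊗_A K` is exact for every left `A`-module `K`. -/
def PureExact {A : Type u} [Ring A] (S : ShortComplex (ModuleCat.{u} Aᵐᵒᵖ)) : Prop :=
  S.ShortExact ∧ ∀ K : ModuleCat.{u} A, Function.Injective (BalTensor.map (R := A) K S.f.hom)

/-- A sequence in `Mod-R` is pure-exact if it is so at each object of `C`. -/
def StrictMod.PureExact {R : C ⥤ RingCat.{u}} (S : ShortComplex (StrictMod R)) : Prop :=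
  ∀ c : C, RepMod.PureExact (S.map (StrictMod.eval R c))

/-! ### The induced representation `R_fp` -/

/-- The category `mod-A` of finitely presented right `A`-modules. -/
abbrev FPMod (A : Type u) [Ring A] : Type (u + 1) :=
  ObjectProperty.FullSubcategory
    (fun M : ModuleCat.{u} Aᵐᵒᵖ => Module.FinitePresentation Aᵐᵒᵖ M)

/-- The functor `φ_! : mod-A → mod-B`. -/
def fpExt {A B : Type u} [Ring A] [Ring B] (φ : A →+* B) : FPMod A ⥤ FPMod B where
  obj F := ⟨ModuleCat.of Bᵐᵒᵖ (Ext φ F.obj), by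
    have := F.property
    exact Ext.finitePresentation φ⟩
  map f := ObjectProperty.homMk (ModuleCat.ofHom (Ext.map φ f.hom.hom))
  map_id F := by
    ext1
    refine ModuleCat.hom_ext (Ext.hom_ext fun x => ?_)
    rfl
  map_comp f g := by
    ext1
    refine ModuleCat.hom_ext (Ext.hom_ext fun x => ?_)
    rfl

instance {A B : Type u} [Ring A] [Ring B] (φ : A →+* B) : (fpExt φ).Additive where
  map_add {F G f g} := by
    ext1
    refine ModuleCat.hom_ext (Ext.hom_ext fun x => ?_)
    exact Ext.add_mk φ _ _ _

/-- The isomorphism `F → F ⊗_A A` along `φ = id`, `f ↦ f ⊗ 1`. -/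
def fpExtId {A : Type u} [Ring A] (φ : A →+* A) (hφ : φ = RingHom.id A) :
    𝟭 (FPMod A) ≅ fpExt φ :=
  NatIso.ofComponents (fun F => ObjectProperty.isoMk _ (Ext.idEquiv φ hφ F.obj).toModuleIso)
    (fun f => by
      ext1
      exact ModuleCat.hom_ext (LinearMap.ext fun x => rfl))

/-- The isomorphism `(F ⊗_A B) ⊗_B D → F ⊗_A D`, `(f ⊗ b) ⊗ d ↦ f ⊗ ψ b * d`, for ring
homomorphisms `φ : A → B`, `ψ : B → D` and `χ = ψ ∘ φ`. -/
def fpExtComp {A B D : Type u} [Ring A] [Ring B] [Ring D] (φ : A →+* B) (ψ : B →+* D)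
    (χ : A →+* D) (hχ : ψ.comp φ = χ) : fpExt φ ⋙ fpExt ψ ≅ fpExt χ :=
  NatIso.ofComponents
    (fun F => ObjectProperty.isoMk _ (Ext.compEquiv φ ψ χ hχ F.obj).toModuleIso)
    (fun f => by
      ext1
      exact ModuleCat.hom_ext (Ext.hom_ext₂ fun x => rfl))

/-- The induced representation `R_fp`, with `R_fp(c) = mod-R_c` and `R_fp(α) = α_!`. -/
def Rfp (R : C ⥤ RingCat.{u}) : AddRep.{u + 1, u} C where
  obj c := FPMod (R.obj c)
  map α := fpExt (R.map α).hom
  δ c := fpExtId (R.map (𝟙 c)).hom (by simp)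
  μ α β γ h := fpExtComp (R.map α).hom (R.map β).hom (R.map γ).hom (by simp [← h])
  assoc {c d e f} α β γ αβ βγ αβγ h₁ h₂ h₃ h₄ F := by
    ext1
    exact ModuleCat.hom_ext (LinearMap.ext fun z => Ext.compEquiv_assoc (R.map α).hom
      (R.map β).hom (R.map γ).hom (R.map αβ).hom (R.map βγ).hom (R.map αβγ).hom
      (by simp [← h₁]) (by simp [← h₂]) (by simp [← h₃]) (by simp [← h₄]) z)
  unit_left α h F := by
    ext1
    refine ModuleCat.hom_ext (Ext.hom_ext fun x => ?_)
    change Ext.mk (R.map α).hom x ((R.map α).hom 1 * 1) = Ext.mk _ x 1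
    rw [map_one, one_mul]
  unit_right α h F := by
    ext1
    refine ModuleCat.hom_ext (Ext.hom_ext fun x => ?_)
    change Ext.mk (R.map α).hom x ((R.map (𝟙 _)).hom 1 * 1) = Ext.mk _ x 1
    rw [map_one, one_mul]

/-- The functor `Y_A(M) = Hom_A(-, M) : (mod-A)ᵒᵖ → Ab` for a right `A`-module `M`. -/
def fpYoneda {A : Type u} [Ring A] (M : ModuleCat.{u} Aᵐᵒᵖ) : (FPMod A)ᵒᵖ ⥤ AddCommGrpCat.{u} where
  obj F := AddCommGrpCat.of (F.unop.obj ⟶ M)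
  map g := AddCommGrpCat.ofHom (Preadditive.leftComp M g.unop.hom)
  map_id _ := AddCommGrpCat.ext fun f => Category.id_comp f
  map_comp g h := AddCommGrpCat.ext fun f => Category.assoc h.unop.hom g.unop.hom f

instance {A : Type u} [Ring A] (M : ModuleCat.{u} Aᵐᵒᵖ) : (fpYoneda M).Additive where
  map_add {_ _ g h} :=
    AddCommGrpCat.ext fun f => Preadditive.add_comp _ _ _ g.unop.hom h.unop.hom f

/-- `Y_A` on morphisms: `Y_A(φ) = Hom_A(-, φ)`. -/
def fpYonedaMap {A : Type u} [Ring A] {M N : ModuleCat.{u} Aᵐᵒᵖ} (φ : M ⟶ N) :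
    fpYoneda M ⟶ fpYoneda N where
  app F := AddCommGrpCat.ofHom (Preadditive.rightComp F.unop.obj φ)
  naturality _ _ g := AddCommGrpCat.ext fun f => Category.assoc g.unop.hom f φ

/-- For a homomorphism `m : M → φ^* L` and `f : F → M`, the adjoint `φ_! F → L` of `m ∘ f`,
that is, `x ⊗ s ↦ m (f x) · s`. -/
def fpYonedaAdj {A B : Type u} [Ring A] [Ring B] (φ : A →+* B) {M : ModuleCat.{u} Aᵐᵒᵖ}
    {L : ModuleCat.{u} Bᵐᵒᵖ} (m : M →ₛₗ[RingHom.op φ] L) :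
    fpYoneda M ⟶ (fpExt φ).op ⋙ fpYoneda L where
  app F := AddCommGrpCat.ofHom (AddMonoidHom.mk'
    (fun f : F.unop.obj ⟶ M =>
      (ModuleCat.ofHom (Ext.lift φ (m.comp f.hom)) : ModuleCat.of _ (Ext φ F.unop.obj) ⟶ L))
    (fun f g => by
      refine ModuleCat.hom_ext (Ext.hom_ext fun x => ?_)
      change (1 : Bᵐᵒᵖ) • m (f.hom x + g.hom x) =
        (1 : Bᵐᵒᵖ) • m (f.hom x) + (1 : Bᵐᵒᵖ) • m (g.hom x)
      rw [map_add, smul_add]))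
  naturality _ _ g := AddCommGrpCat.ext fun f =>
    ModuleCat.hom_ext (Ext.hom_ext fun x => rfl)

/-- The `R_fp`-module `Y(M)`: `Y(M)_c = Hom(-, M_c)` on `mod-R_c`, and `Y(M)_α` sends
`f : F → M_c` to the adjoint `α_! F → M_d` of `M_α ∘ f : F → α^* M_d`. -/
def yonedaObj {R : C ⥤ RingCat.{u}} (M : StrictMod R) : Mod.{u + 1, u, v₁, u₁, u} (Rfp R) where
  obj c := fpYoneda (M.obj c)
  additive c := inferInstanceAs (fpYoneda (M.obj c)).Additive
  map α := fpYonedaAdj (R.map α).hom (M.map α)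
  map_comp {c d e} α β γ h F := by
    subst h
    refine AddCommGrpCat.ext fun (f : F.obj ⟶ M.obj c) =>
      ModuleCat.hom_ext (Ext.hom_ext₂ fun x => ?_)
    change op ((R.map β).hom 1 * 1) • M.map (α ≫ β) (f.hom x) =
      (1 : (R.obj e)ᵐᵒᵖ) • M.map β ((1 : (R.obj d)ᵐᵒᵖ) • M.map α (f.hom x))
    rw [map_one, one_mul, op_one, one_smul, one_smul, one_smul, M.map_comp]
  map_id c F := by
    refine AddCommGrpCat.ext fun (f : F.obj ⟶ M.obj c) =>
      ModuleCat.hom_ext (LinearMap.ext fun x => ?_)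
    change (1 : (R.obj c)ᵐᵒᵖ) • M.map (𝟙 c) (f.hom x) = f.hom x
    rw [one_smul, M.map_id]

/-- The Yoneda functor `Y : Mod-R ⥤ Mod-R_fp`. -/
def yoneda (R : C ⥤ RingCat.{u}) : StrictMod R ⥤ Mod.{u + 1, u, v₁, u₁, u} (Rfp R) where
  obj M := yonedaObj M
  map {M Z} φ :=
    { app := fun c => fpYonedaMap (φ.app c)
      naturality := fun {c d} α => by
        refine NatTrans.ext (funext fun F => AddCommGrpCat.ext fun f =>
          ModuleCat.hom_ext (Ext.hom_ext fun x => ?_))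
        change (φ.app d).hom ((1 : (R.obj d)ᵐᵒᵖ) • M.map α (f.hom x)) =
          (1 : (R.obj d)ᵐᵒᵖ) • Z.map α ((φ.app c).hom (f.hom x))
        rw [one_smul, one_smul, φ.naturality] }
  map_id M := Mod.hom_ext fun c => NatTrans.ext (funext fun F => AddCommGrpCat.ext fun f =>
    Category.comp_id (X := F.unop.obj) (Y := M.obj c) f)
  map_comp {M N L} φ ψ := Mod.hom_ext fun c => NatTrans.ext (funext fun F =>
    AddCommGrpCat.ext fun (f : F.unop.obj ⟶ M.obj c) =>
      (Category.assoc f (φ.app c) (ψ.app c)).symm)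

instance (R : C ⥤ RingCat.{u}) : (yoneda R).Additive where
  map_add {M _ φ ψ} := Mod.hom_ext fun c => NatTrans.ext (funext fun F =>
    AddCommGrpCat.ext fun (f : F.unop.obj ⟶ M.obj c) =>
      Preadditive.comp_add _ _ _ f (φ.app c) (ψ.app c))

end Strict

end RepMod

/-! Both conditions say that, for every object `c` and every finitely presented right `R_c`-module
`F`, the map `Hom(F, M_c) → Hom(F, (M/N)_c)` is surjective.

Over a single ring this is the classical characterisation of purity (`pureExact_iff_surjective`).
The link is a third condition, `ReflectsSolvability`: a finite linear system with constants in `N`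
and a solution in `M` has one in `N`. Such a system is a finite matrix. Read through its rows, it
presents a module from which maps are to be lifted; read through its columns, it presents a left
module to tensor with.

For the Yoneda side, `Hom(F, -)` is left exact, so only surjectivity on the right is in question.
What remains is that exactness is pointwise. In `Mod-R`, short exactness passes to each `c`
(`StrictMod.shortExact_eval`). In `Mod-R_fp`, pointwise short exactness gives short exactness
(`Mod.shortExact_of_eval`), and an epimorphism is pointwise epi (`Mod.epi_app`). The pointwise
kernels and cokernels are built by hand, and short exactness is derived from the universal
properties of the two maps. -/

namespace RepMod

/-! ### Linear systems and lifting maps from finitely presented modules. -/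

section Systems

variable {B : Type*} [Ring B] {N M L : Type*} [AddCommGroup N] [Module B N]
  [AddCommGroup M] [Module B M] [AddCommGroup L] [Module B L]

/-- Every finite system of linear equations with constants in `N` that is solvable in `M` is
solvable in `N`. -/
def ReflectsSolvability (f : N →ₗ[B] M) : Prop :=
  ∀ (m n : ℕ) (b : Fin m → Fin n → B) (c : Fin m → N) (y : Fin n → M),
    (∀ i, ∑ j, b i j • y j = f (c i)) → ∃ y' : Fin n → N, ∀ i, ∑ j, b i j • y' j = c i

/-- Needed because systems extracted from tensor relations are indexed by subtypes of finite sets.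
-/
theorem ReflectsSolvability.of_fintype {f : N →ₗ[B] M} (hf : ReflectsSolvability f)
    {ι J : Type*} [Fintype ι] [Fintype J] (b : ι → J → B) (c : ι → N) (y : J → M)
    (h : ∀ i, ∑ j, b i j • y j = f (c i)) : ∃ y' : J → N, ∀ i, ∑ j, b i j • y' j = c i := by
  let e := Fintype.equivFin ι
  let e' := Fintype.equivFin J
  obtain ⟨y', hy'⟩ := hf _ _ (fun i j => b (e.symm i) (e'.symm j)) (c ∘ e.symm) (y ∘ e'.symm)
    (fun i => (e'.symm.sum_comp fun j => b (e.symm i) j • y j).trans (h _))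
  refine ⟨y' ∘ e', fun i => ?_⟩
  have h2 := hy' (e i)
  rw [← e'.sum_comp] at h2
  simpa using h2

/-- If systems of equations can be solved in `N`, then homomorphisms from finitely presented
modules lift along `M → L`. -/
theorem ReflectsSolvability.exists_lift {f : N →ₗ[B] M} (hf : ReflectsSolvability f)
    {g : M →ₗ[B] L} (hfg : Function.Exact f g) (hg : Function.Surjective g)
    {F : Type*} [AddCommGroup F] [Module B F] [Module.FinitePresentation B F] (h : F →ₗ[B] L) :
    ∃ l : F →ₗ[B] M, g.comp l = h := by
  classical
  obtain ⟨n, m, p, q, hp, hpq⟩ := Module.FinitePresentation.exists_fin' B F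
  choose y hy using fun j : Fin n => hg (h (p (Pi.single j 1)))
  have expand : ∀ (v : Fin n → B), v = ∑ j, v j • (Pi.single j 1 : Fin n → B) :=
    fun v => pi_eq_sum_univ' v
  -- The rows `q (Pi.single i 1)` generate the relations of `F`, so they vanish on the images in `L`
  -- of the chosen `y j`; in `M` they take values in the image of `f`.
  have h0 : ∀ i : Fin m, g (∑ j, q (Pi.single i 1) j • y j) = 0 := by
    intro i
    simp only [map_sum, map_smul, hy]
    have := congrArg (fun v => h (p v)) (expand (q (Pi.single i 1)))
    simp only [map_sum, map_smul, hpq.apply_apply_eq_zero, map_zero] at this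
    exact this.symm
  choose c hc using fun i => (hfg _).1 (h0 i)
  obtain ⟨y', hy'⟩ := hf m n (fun i j => q (Pi.single i 1) j) c y (fun i => (hc i).symm)
  -- Subtracting the solution found in `N` makes the preimages satisfy the relations of `F` and does
  -- not change their images in `L`.
  let l : (Fin n → B) →ₗ[B] M := Fintype.linearCombination B (fun j => y j - f (y' j))
  have hlq : l.comp q = 0 := by
    refine LinearMap.pi_ext' fun i => LinearMap.ext_ring ?_
    change l (q (Pi.single i 1)) = 0
    simp only [l, Fintype.linearCombination_apply, smul_sub, Finset.sum_sub_distrib, ← map_smul,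
      ← map_sum, hy', hc, sub_self]
  have hl : LinearMap.ker p ≤ LinearMap.ker l := by
    intro v hv
    obtain ⟨z, rfl⟩ := (hpq v).1 hv
    exact DFunLike.congr_fun hlq z
  refine ⟨((LinearMap.ker p).liftQ l hl).comp
    (p.quotKerEquivOfSurjective hp).symm.toLinearMap, ?_⟩
  rw [← LinearMap.cancel_right hp]
  refine LinearMap.pi_ext' fun j => LinearMap.ext_ring ?_
  have e : (p.quotKerEquivOfSurjective hp).symm (p (Pi.single j 1)) =
      (LinearMap.ker p).mkQ (Pi.single j 1) := by
    rw [LinearEquiv.symm_apply_eq]; rfl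
  change g ((LinearMap.ker p).liftQ l hl
    ((p.quotKerEquivOfSurjective hp).symm (p (Pi.single j 1)))) = h (p (Pi.single j 1))
  rw [e]
  change g (l (Pi.single j 1)) = _
  simp [l, Fintype.linearCombination_apply, Pi.single_apply, hfg.apply_apply_eq_zero, hy]

end Systems

/-- If homomorphisms from finitely presented modules lift along `M → L`, then systems of equations
can be solved in `N`. -/
theorem reflectsSolvability_of_exists_lift {B : Type u} [Ring B] {N M L : Type*} [AddCommGroup N]
    [Module B N] [AddCommGroup M] [Module B M] [AddCommGroup L] [Module B L]
    {f : N →ₗ[B] M} {g : M →ₗ[B] L} (hf : Function.Injective f) (hfg : Function.Exact f g)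
    (H : ∀ (F : Type u) [AddCommGroup F] [Module B F] [Module.FinitePresentation B F]
      (h : F →ₗ[B] L), ∃ l : F →ₗ[B] M, g.comp l = h) : ReflectsSolvability f := by
  classical
  intro m n b c y h
  -- The rows of the system become the relations of a finitely presented module. As `y` solves the
  -- system modulo the image of `f`, it defines a map from that module to `L`.
  let W : Submodule B (Fin n → B) := Submodule.span B (Set.range b)
  have : Module.FinitePresentation B ((Fin n → B) ⧸ W) := by
    refine Module.finitePresentation_of_surjective W.mkQ W.mkQ_surjective ?_
    rw [Submodule.ker_mkQ]
    exact Submodule.fg_span (Set.finite_range _)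
  let k : (Fin n → B) →ₗ[B] M := Fintype.linearCombination B y
  have hk : W ≤ LinearMap.ker (g.comp k) := by
    rw [Submodule.span_le]
    rintro _ ⟨i, rfl⟩
    change g (k (b i)) = 0
    rw [show k (b i) = f (c i) from h i, hfg.apply_apply_eq_zero]
  obtain ⟨l, hl⟩ := H _ (W.liftQ (g.comp k) hk)
  -- The lift `l` satisfies the homogeneous system, so subtracting it moves `y` into the kernel of
  -- `g` and leaves the right-hand sides unchanged.
  have h0 : ∀ j, g (y j - l (W.mkQ (Pi.single j 1))) = 0 := by
    intro j
    rw [map_sub, ← LinearMap.comp_apply, hl, sub_eq_zero]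
    change _ = g (k (Pi.single j 1))
    simp [k, Fintype.linearCombination_apply, Pi.single_apply]
  choose y' hy' using fun j => (hfg _).1 (h0 j)
  refine ⟨y', fun i => hf ?_⟩
  have hb : W.mkQ (b i) = 0 :=
    (Submodule.Quotient.mk_eq_zero W).2 (Submodule.subset_span ⟨i, rfl⟩)
  have e : b i = ∑ j, b i j • (Pi.single j 1 : Fin n → B) := pi_eq_sum_univ' (b i)
  have e2 : ∑ j, b i j • l (W.mkQ (Pi.single j 1)) = 0 := by
    rw [← map_zero l, ← hb]
    conv_rhs => rw [e]
    simp only [map_sum, map_smul]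
  simp only [map_sum, map_smul, hy', smul_sub, Finset.sum_sub_distrib, e2, sub_zero, h]

/-! ### Linear systems and injectivity after tensoring. -/

section Purity

variable {A : Type u} [Ring A] {N M : Type*} [AddCommGroup N] [Module Aᵐᵒᵖ N]
  [AddCommGroup M] [Module Aᵐᵒᵖ M]

/-- The homomorphism `y ⊗ r ↦ y · r` from `M ⊗ Rel` to `M^(K)`, where `Rel` is the module of
relations between the elements of `K`, in terms of families of elements of `M`. -/
noncomputable def relHom (A : Type u) [Ring A] (M : Type*) [AddCommGroup M] [Module Aᵐᵒᵖ M]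
    (K : Type u) [AddCommGroup K] [Module A K] :
    (LinearMap.ker (Finsupp.linearCombination A (id : K → K)) →₀ M) →+ (K →₀ M) :=
  Finsupp.liftAddHom fun r => AddMonoidHom.mk'
    (fun y => r.1.mapRange (fun a => op a • y) (zero_smul _ _))
    (fun x y => by ext k; simp)

theorem relHom_single {K : Type u} [AddCommGroup K] [Module A K]
    (r : LinearMap.ker (Finsupp.linearCombination A (id : K → K))) (y : M) :
    relHom A M K (Finsupp.single r y) = r.1.mapRange (fun a => op a • y) (zero_smul _ _) :=
  Finsupp.liftAddHom_apply_single _ r y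

/-- The map `M ⊗_A K → M^(K) / im(relHom)`, `x ⊗ k ↦ single k x`. -/
noncomputable def tensorToFinsupp (A : Type u) [Ring A] (M : Type*) [AddCommGroup M]
    [Module Aᵐᵒᵖ M] (K : Type u) [AddCommGroup K] [Module A K] :
    BalTensor A M K →+ (K →₀ M) ⧸ (relHom A M K).range :=
  BalTensor.lift
    (AddMonoidHom.mk' (fun x => AddMonoidHom.mk'
        (fun k => QuotientAddGroup.mk' _ (Finsupp.single k x))
        (fun k l => by
          rw [← map_add, ← sub_eq_zero, ← map_sub]
          -- Additivity in `k` comes from the relation `[k + l] - [k] - [l]`; balancedness comes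
          -- from `a[k] - [a • k]`.
          refine (QuotientAddGroup.eq_zero_iff _).2 ⟨Finsupp.single
            ⟨Finsupp.single (k + l) 1 - (Finsupp.single k 1 + Finsupp.single l 1), by simp⟩ x, ?_⟩
          classical
          rw [relHom_single]
          ext i
          simp only [Finsupp.mapRange_apply, Finsupp.sub_apply, Finsupp.add_apply,
            Finsupp.single_apply]
          split_ifs <;> simp [add_smul]))
      (fun x y => by ext k; simp))
    (fun x a k => by
      change QuotientAddGroup.mk' _ _ = QuotientAddGroup.mk' _ _
      rw [← sub_eq_zero, ← map_sub]
      refine (QuotientAddGroup.eq_zero_iff _).2 ⟨Finsupp.single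
        ⟨Finsupp.single k a - Finsupp.single (a • k) 1, by simp⟩ x, ?_⟩
      classical
      rw [relHom_single]
      ext i
      simp only [Finsupp.mapRange_apply, Finsupp.sub_apply, Finsupp.single_apply]
      split_ifs <;> simp [sub_smul])

/-- The homomorphism `M^(K) → M ⊗_A K`, `single k x ↦ x ⊗ k`. -/
noncomputable def finsuppToTensor (A : Type u) [Ring A] (M : Type*) [AddCommGroup M]
    [Module Aᵐᵒᵖ M] (K : Type u) [AddCommGroup K] [Module A K] :
    (K →₀ M) →+ BalTensor A M K :=
  Finsupp.liftAddHom fun k => AddMonoidHom.mk' (fun x => BalTensor.tmul A x k)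
    (fun x y => BalTensor.add_tmul A x y k)

theorem finsuppToTensor_single {K : Type u} [AddCommGroup K] [Module A K] (k : K) (x : M) :
    finsuppToTensor A M K (Finsupp.single k x) = BalTensor.tmul A x k :=
  Finsupp.liftAddHom_apply_single _ k x

theorem BalTensor.tmul_zero {K : Type*} [AddCommGroup K] [Module A K] (x : M) :
    BalTensor.tmul A x (0 : K) = 0 := by
  simpa using BalTensor.tmul_add A x (0 : K) 0

theorem BalTensor.tmul_sum {K : Type*} [AddCommGroup K] [Module A K] (x : M) {ι : Type*}
    (s : Finset ι) (k : ι → K) :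
    BalTensor.tmul A x (∑ i ∈ s, k i) = ∑ i ∈ s, BalTensor.tmul A x (k i) :=
  map_sum (AddMonoidHom.mk' (fun k => BalTensor.tmul A x k) (BalTensor.tmul_add A x)) k s

/-- A relation `∑ r_k • k = 0` gives `∑ (y · r_k) ⊗ k = y ⊗ ∑ r_k • k = 0`. Together with
`tensorToFinsupp` this presents `M ⊗_A K` as the cokernel of `relHom`. -/
theorem finsuppToTensor_relHom {K : Type u} [AddCommGroup K] [Module A K] :
    (finsuppToTensor A M K).comp (relHom A M K) = 0 := by
  refine Finsupp.addHom_ext fun r y => ?_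
  have hr : ∑ k ∈ r.1.support, r.1 k • k = 0 := r.2
  rw [AddMonoidHom.comp_apply, relHom_single, finsuppToTensor, Finsupp.liftAddHom_apply,
    Finsupp.sum_mapRange_index (fun _ => map_zero _), Finsupp.sum]
  simp only [AddMonoidHom.mk'_apply, BalTensor.smul_tmul, ← BalTensor.tmul_sum, hr,
    BalTensor.tmul_zero, AddMonoidHom.zero_apply]

theorem finsuppToTensor_surjective {K : Type u} [AddCommGroup K] [Module A K] :
    Function.Surjective (finsuppToTensor A M K) := by
  rw [← AddMonoidHom.range_eq_top, ← QuotientAddGroup.ker_mk' (finsuppToTensor A M K).range,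
    AddMonoidHom.ker_eq_top_iff]
  refine BalTensor.hom_ext fun x k => ?_
  exact (QuotientAddGroup.eq_zero_iff _).2 ⟨Finsupp.single k x, finsuppToTensor_single k x⟩

/-- Maps that reflect solvability are injective after tensoring with any left module. -/
theorem ReflectsSolvability.map_injective {f : N →ₗ[Aᵐᵒᵖ] M} (hf : ReflectsSolvability f)
    (K : Type u) [AddCommGroup K] [Module A K] :
    Function.Injective (BalTensor.map (R := A) K f) := by
  classical
  rw [injective_iff_map_eq_zero]
  intro z hz
  obtain ⟨t, rfl⟩ := finsuppToTensor_surjective z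
  -- If `f ⊗ K` kills the class of `t`, then `f` applied coordinatewise to `t` lies in the image of
  -- `relHom`.
  have e : (tensorToFinsupp A M K).comp ((BalTensor.map (R := A) K f).comp
      (finsuppToTensor A N K)) = (QuotientAddGroup.mk' _).comp
        (Finsupp.mapRange.addMonoidHom f.toAddMonoidHom) := by
    refine Finsupp.addHom_ext fun k x => ?_
    simp [finsuppToTensor_single, tensorToFinsupp]
  have h0 := DFunLike.congr_fun e t
  rw [AddMonoidHom.comp_apply, AddMonoidHom.comp_apply, hz, map_zero] at h0
  obtain ⟨y, hy⟩ := (QuotientAddGroup.eq_zero_iff _).1 h0.symm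
  -- Coordinate by coordinate, this is a linear system with constants `t k`, one unknown for each
  -- relation in the support of `y`, solved in `M`.
  have hsum : ∀ k : K, ∑ r : y.support, op (r.1.1 k) • y r.1 = f (t k) := by
    intro k
    have := DFunLike.congr_fun hy k
    simp only [Finsupp.mapRange.addMonoidHom_apply, Finsupp.mapRange_apply] at this
    rw [Finset.sum_coe_sort y.support (fun r => op (r.1 k) • y r)]
    refine Eq.trans ?_ this
    simp [relHom, Finsupp.sum, Finsupp.finsetSum_apply]
  -- Outside `s` the constants and all coefficients vanish, so finitely many equations suffice.
  let s : Finset K := t.support ∪ y.support.biUnion fun r => r.1.support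
  obtain ⟨y', hy'⟩ := hf.of_fintype (fun (k : s) (r : y.support) => op (r.1.1 k.1))
    (fun k => t k.1) (fun r => y r.1) (fun k => hsum k.1)
  have ht : t = relHom A N K (∑ r : y.support, Finsupp.single r.1 (y' r)) := by
    ext k
    simp only [map_sum, relHom_single, Finsupp.finsetSum_apply, Finsupp.mapRange_apply]
    by_cases hk : k ∈ s
    · exact (hy' ⟨k, hk⟩).symm
    · simp only [s, Finset.mem_union, Finset.mem_biUnion, not_or, not_exists, not_and,
        Finsupp.notMem_support_iff] at hk
      rw [hk.1, eq_comm]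
      exact Finset.sum_eq_zero fun r _ => by rw [hk.2 r.1 r.2, op_zero, zero_smul]
  rw [ht]
  exact DFunLike.congr_fun finsuppToTensor_relHom _

/-- Maps that are injective after tensoring with every left module reflect
solvability. -/
theorem reflectsSolvability_of_map_injective {f : N →ₗ[Aᵐᵒᵖ] M}
    (hf : ∀ (K : Type u) [AddCommGroup K] [Module A K],
      Function.Injective (BalTensor.map (R := A) K f)) : ReflectsSolvability f := by
  classical
  intro m n b c y h
  -- The test module has generators `e i` and the columns of `b` as relations.
  let W : Submodule A (Fin m → A) :=
    Submodule.span A (Set.range fun (j : Fin n) (i : Fin m) => (b i j).unop)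
  let e : Fin m → (Fin m → A) ⧸ W := fun i => W.mkQ (Pi.single i 1)
  have rel : ∀ j, ∑ i, (b i j).unop • e i = 0 := by
    intro j
    have e1 := pi_eq_sum_univ' (fun i => (b i j).unop)
    simp only [e, ← map_smul, ← map_sum]
    exact (Submodule.Quotient.mk_eq_zero W).2 (e1 ▸ Submodule.subset_span ⟨j, rfl⟩)
  -- After `f` the sum becomes `∑ j, y j ⊗ ∑ i, (b i j).unop • e i`, which is zero by the column
  -- relations.
  have hz : ∑ i, BalTensor.tmul A (c i) (e i) = 0 := by
    apply hf ((Fin m → A) ⧸ W)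
    rw [map_zero, map_sum]
    have hs : ∀ (x : Fin n → M) (k : (Fin m → A) ⧸ W),
        BalTensor.tmul A (∑ j, x j) k = ∑ j, BalTensor.tmul A (x j) k := fun x k =>
      map_sum (AddMonoidHom.mk' (fun x => BalTensor.tmul A x k)
        (fun x y => BalTensor.add_tmul A x y k)) x Finset.univ
    have hr : ∀ (x : M) (a : Aᵐᵒᵖ) (k : (Fin m → A) ⧸ W),
        BalTensor.tmul A (a • x) k = BalTensor.tmul A x (a.unop • k) :=
      fun x a k => BalTensor.smul_tmul A x a.unop k
    simp only [BalTensor.map_tmul, ← h, hs, hr]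
    rw [Finset.sum_comm]
    exact Finset.sum_eq_zero fun j _ => by rw [← BalTensor.tmul_sum, rel, BalTensor.tmul_zero]
  let G : (Fin n → N) →+ (Fin m → N) := AddMonoidHom.mk' (fun y i => ∑ j, b i j • y j)
    (fun y z => by ext i; simp [Finset.sum_add_distrib])
  let act : N → (Fin m → A) →+ (Fin m → N) := fun x => AddMonoidHom.mk'
    (fun a i => op (a i) • x) (fun a a' => by ext i; simp [add_smul])
  have hact : ∀ (x : N) (a : Fin m → A), a ∈ W → act x a ∈ G.range := by
    intro x a ha
    -- The claim is kept for all `x` because a left scalar on `a` is moved onto `x`.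
    induction ha using Submodule.span_induction generalizing x with
    | mem a ha =>
      obtain ⟨j, rfl⟩ := ha
      refine ⟨Pi.single j x, ?_⟩
      ext i
      simp [G, act, Pi.single_apply]
    | zero => rw [map_zero]; exact zero_mem _
    | add a a' _ _ h1 h2 => rw [map_add]; exact add_mem (h1 x) (h2 x)
    | smul r a _ h1 =>
      have : act x (r • a) = act (op r • x) a := by
        ext i; simp [act, mul_smul]
      rw [this]
      exact h1 _
  -- `T` maps `N ⊗ K` to the cokernel of the system map `G` and sends `∑ c i ⊗ e i` to the class of
  -- `c`; that class is therefore zero, so the system is solvable.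
  let T : BalTensor A N ((Fin m → A) ⧸ W) →+ (Fin m → N) ⧸ G.range := BalTensor.lift
    (AddMonoidHom.mk' (fun x => QuotientAddGroup.lift W.toAddSubgroup
        ((QuotientAddGroup.mk' G.range).comp (act x))
        (fun a ha => (QuotientAddGroup.eq_zero_iff _).2 (hact x a ha)))
      (fun x x' => by
        refine QuotientAddGroup.addMonoidHom_ext _ (AddMonoidHom.ext fun a => ?_)
        change QuotientAddGroup.mk' G.range (act (x + x') a) =
          QuotientAddGroup.mk' G.range (act x a) + QuotientAddGroup.mk' G.range (act x' a)
        rw [← map_add]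
        congr 1
        ext i
        simp [act]))
    (fun x r k => by
      obtain ⟨a, rfl⟩ := W.mkQ_surjective k
      change QuotientAddGroup.mk' G.range (act (op r • x) a) =
        QuotientAddGroup.mk' G.range (act x (r • a))
      congr 1
      ext i
      simp [act, mul_smul])
  have hT := congrArg T hz
  rw [map_zero, map_sum] at hT
  have hT2 : QuotientAddGroup.mk' G.range c = 0 := by
    rw [← hT]
    change _ = ∑ i, QuotientAddGroup.mk' G.range (act (c i) (Pi.single i 1))
    rw [← map_sum]
    congr 1
    ext i
    simp [act, Pi.single_apply, apply_ite, ite_smul]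
  obtain ⟨y', hy'⟩ := (QuotientAddGroup.eq_zero_iff _).1 hT2
  exact ⟨y', fun i => congrFun hy' i⟩

end Purity

/-- A short exact sequence is pure-exact if and only if `Hom(F, M) → Hom(F, L)` is surjective for
all finitely presented `F`. -/
theorem pureExact_iff_surjective {A : Type u} [Ring A] {S : ShortComplex (ModuleCat.{u} Aᵐᵒᵖ)}
    (hS : S.ShortExact) :
    PureExact S ↔ ∀ F : FPMod A, Function.Surjective fun h : F.obj ⟶ S.X₂ => h ≫ S.g := by
  have hfg := (ShortComplex.ShortExact.moduleCat_exact_iff_function_exact S).1 hS.exact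
  constructor
  · rintro ⟨-, hp⟩ F h
    have := F.property
    obtain ⟨l, hl⟩ := (reflectsSolvability_of_map_injective (f := S.f.hom)
      (fun K _ _ => hp (ModuleCat.of A K))).exists_lift hfg hS.moduleCat_surjective_g h.hom
    exact ⟨ModuleCat.ofHom l, ModuleCat.hom_ext hl⟩
  · intro H
    refine ⟨hS, fun K => ReflectsSolvability.map_injective ?_ K⟩
    refine reflectsSolvability_of_exists_lift hS.moduleCat_injective_f hfg fun F _ _ hF h => ?_
    obtain ⟨l, hl⟩ := H ⟨ModuleCat.of Aᵐᵒᵖ F, hF⟩ (ModuleCat.ofHom h)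
    exact ⟨l.hom, congrArg ModuleCat.Hom.hom hl⟩

end RepMod

namespace RepMod

/-! ### Short exact sequences in `Mod-R` are pointwise short exact. -/

section Strict

variable {C : Type u₁} [Category.{v₁} C] {R : C ⥤ RingCat.{u}}

namespace StrictMod

variable {M N : StrictMod R}

/-- The pointwise kernel of a morphism of right modules. -/
def ker (φ : M ⟶ N) : StrictMod R where
  obj c := ModuleCat.of _ (LinearMap.ker (φ.app c).hom)
  map {c d} α :=
    { toFun := fun x => ⟨M.map α x.1, by
        rw [LinearMap.mem_ker, φ.naturality, LinearMap.mem_ker.1 x.2, map_zero]⟩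
      map_add' := fun x y => Subtype.ext (map_add (M.map α) x.1 y.1)
      map_smul' := fun r x => Subtype.ext (map_smulₛₗ (M.map α) r x.1) }
  map_comp α β x := Subtype.ext (M.map_comp α β x.1)
  map_id c x := Subtype.ext (M.map_id c x.1)

/-- The inclusion of the pointwise kernel. -/
def kerι (φ : M ⟶ N) : ker φ ⟶ M :=
  Hom.mk (fun c => ModuleCat.ofHom (LinearMap.ker (φ.app c).hom).subtype) (fun _ _ => rfl)

theorem kerι_comp (φ : M ⟶ N) : kerι φ ≫ φ = 0 :=
  hom_ext fun _ => ModuleCat.hom_ext (LinearMap.ext fun x => x.2)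

/-- The pointwise cokernel of a morphism of right modules. -/
def coker (φ : M ⟶ N) : StrictMod R where
  obj c := ModuleCat.of _ (N.obj c ⧸ LinearMap.range (φ.app c).hom)
  map {c d} α := Submodule.mapQ _ _ (N.map α) (by
    rintro _ ⟨x, rfl⟩
    exact ⟨M.map α x, φ.naturality α x⟩)
  map_comp {c d e} α β x := by
    obtain ⟨x, rfl⟩ := Submodule.mkQ_surjective _ x
    exact congrArg (Submodule.mkQ _) (N.map_comp α β x)
  map_id c x := by
    obtain ⟨x, rfl⟩ := Submodule.mkQ_surjective _ x
    exact congrArg (Submodule.mkQ _) (N.map_id c x)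

/-- The projection to the pointwise cokernel. -/
def cokerπ (φ : M ⟶ N) : N ⟶ coker φ :=
  Hom.mk (fun c => ModuleCat.ofHom (LinearMap.range (φ.app c).hom).mkQ) (fun _ _ => rfl)

theorem comp_cokerπ (φ : M ⟶ N) : φ ≫ cokerπ φ = 0 :=
  hom_ext fun _ => ModuleCat.hom_ext (LinearMap.ext fun x =>
    (Submodule.Quotient.mk_eq_zero _).2 ⟨x, rfl⟩)

/-- The projection to the pointwise cokernel vanishes after the epimorphism `φ`, hence is zero. -/
theorem app_surjective (φ : M ⟶ N) [Epi φ] (c : C) : Function.Surjective (φ.app c).hom := by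
  have h : cokerπ φ = 0 := (cancel_epi φ).1 (by rw [comp_cokerπ, Limits.comp_zero])
  intro y
  have h2 := LinearMap.congr_fun (congrArg (fun ψ : N ⟶ coker φ => (ψ.app c).hom) h) y
  exact (Submodule.Quotient.mk_eq_zero _).1 h2

theorem app_injective (φ : M ⟶ N) [Mono φ] (c : C) : Function.Injective (φ.app c).hom := by
  have h : kerι φ = 0 := (cancel_mono φ).1 (by rw [kerι_comp, Limits.zero_comp])
  rw [← LinearMap.ker_eq_bot, LinearMap.ker_eq_bot']
  intro x hx
  exact LinearMap.congr_fun (congrArg (fun ψ : ker φ ⟶ M => (ψ.app c).hom) h) ⟨x, hx⟩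

/-- Exactness makes the map from `S.X₁` to the categorical kernel of `S.g` epi, hence pointwise
surjective. An element of the pointwise kernel enters the categorical one by its universal property.
-/
theorem exact_app {S : ShortComplex (StrictMod R)} (hS : S.Exact) (c : C) :
    Function.Exact (S.f.app c).hom (S.g.app c).hom := by
  have := hS.hasHomology
  have := hS.epi_f' S.leftHomologyData
  intro x
  constructor
  · intro hx
    obtain ⟨y, hy⟩ := app_surjective S.leftHomologyData.f' c
      (((S.leftHomologyData.liftK (kerι S.g) (kerι_comp S.g)).app c).hom ⟨x, hx⟩)
    refine ⟨y, ?_⟩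
    rw [← S.leftHomologyData.f'_i]
    refine (congrArg (S.leftHomologyData.i.app c).hom hy).trans ?_
    have := congrArg (fun ψ : ker S.g ⟶ S.X₂ => (ψ.app c).hom)
      (S.leftHomologyData.liftK_i (kerι S.g) (kerι_comp S.g))
    exact LinearMap.congr_fun this ⟨x, hx⟩
  · rintro ⟨y, rfl⟩
    exact LinearMap.congr_fun
      (congrArg (fun ψ : S.X₁ ⟶ S.X₃ => (ψ.app c).hom) S.zero) y

theorem shortExact_eval {S : ShortComplex (StrictMod R)} (hS : S.ShortExact) (c : C) :
    (S.map (eval R c)).ShortExact := by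
  have := hS.mono_f
  have := hS.epi_g
  exact ModuleCat.shortComplex_shortExact _ (exact_app hS.exact c) (app_injective S.f c)
    (app_surjective S.g c)

end StrictMod

end Strict

end RepMod

/-! ### Criteria for short exactness. -/

namespace CategoryTheory.ShortComplex

open Limits ZeroObject

/-- A short complex in which each map is a (co)kernel of the other is short exact. -/
theorem shortExact_of_isLimit_of_isColimit {D : Type*} [Category* D] [Preadditive D]
    [HasZeroObject D] {S : ShortComplex D} (hf : IsLimit (KernelFork.ofι S.f S.zero))
    (hg : IsColimit (CokernelCofork.ofπ S.g S.zero)) : S.ShortExact := by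
  have hm : Mono S.f := mono_of_isLimit_fork hf
  have he : Epi S.g := epi_of_isColimit_cofork hg
  have h0 : IsZero (0 : D) := isZero_zero D
  -- The factorisation of `S.f` through its own kernel is the identity, hence epi, so the left
  -- homology is zero; `e'` is the dual.
  have e : hf.lift (KernelFork.ofι S.f S.zero) = 𝟙 S.X₁ :=
    Fork.IsLimit.hom_ext hf ((hf.fac _ WalkingParallelPair.zero).trans (Category.id_comp _).symm)
  have e' : hg.desc (CokernelCofork.ofπ S.g S.zero) = 𝟙 S.X₃ :=
    Cofork.IsColimit.hom_ext hg
      ((hg.fac _ WalkingParallelPair.one).trans (Category.comp_id _).symm)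
  let l : S.LeftHomologyData :=
    { K := S.X₁
      H := 0
      i := S.f
      π := 0
      wi := S.zero
      hi := hf
      wπ := comp_zero
      hπ := CokernelCofork.IsColimit.ofEpiOfIsZero _ (e ▸ inferInstanceAs (Epi (𝟙 S.X₁))) h0 }
  let r : S.RightHomologyData :=
    { Q := S.X₃
      H := 0
      p := S.g
      ι := 0
      wp := S.zero
      hp := hg
      wι := zero_comp
      hι := KernelFork.IsLimit.ofMonoOfIsZero _ (e' ▸ inferInstanceAs (Mono (𝟙 S.X₃))) h0 }
  have comm : l.π ≫ 𝟙 _ ≫ r.ι = l.i ≫ r.p := by simp [l, r]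
  exact ⟨⟨⟨⟨l, r, Iso.refl _, comm⟩, h0⟩⟩⟩

end CategoryTheory.ShortComplex

/-- A short complex of functors that is pointwise short exact is short exact. -/
theorem CategoryTheory.ShortComplex.shortExact_of_evaluation {J D : Type*} [Category* J]
    [Category* D] [Abelian D] {S : ShortComplex (J ⥤ D)}
    (h : ∀ j, (S.map ((evaluation J D).obj j)).ShortExact) : S.ShortExact := by
  have hm : Mono S.f := by
    have : ∀ j, Mono (S.f.app j) := fun j => (h j).mono_f
    exact NatTrans.mono_of_mono_app S.f
  have he : Epi S.g := by
    have : ∀ j, Epi (S.g.app j) := fun j => (h j).epi_g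
    exact NatTrans.epi_of_epi_app S.g
  -- Evaluation commutes with homology, so the homology functor vanishes at every object.
  refine ⟨S.exact_iff_isZero_homology.2 ((Functor.isZero_iff _).2 fun j => ?_)⟩
  exact ((ShortComplex.exact_iff_isZero_homology _).1 (h j).exact).of_iso (S.mapHomologyIso ((evaluation J D).obj j)).symm

namespace RepMod

/-! ### Pointwise exactness in `Mod-R_fp`. -/

namespace Mod

variable {C : Type u₁} [Category.{v₁} C] {P : AddRep.{w, t} C}

/-- The functor `M ↦ M_c`. -/
def eval (P : AddRep.{w, t} C) (c : C) :
    Mod.{w, t, v₁, u₁, u} P ⥤ ((P.obj c)ᵒᵖ ⥤ AddCommGrpCat.{u}) where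
  obj M := M.obj c
  map f := f.app c

instance (c : C) : (eval P c).Additive where

variable {M N : Mod.{w, t, v₁, u₁, u} P}

open Limits

/-- The structure maps of the pointwise cokernel of a morphism of right modules. -/
noncomputable def cokerMap (φ : M ⟶ N) {c d : C} (α : c ⟶ d) :
    cokernel (φ.app c) ⟶ (P.map α).op ⋙ cokernel (φ.app d) :=
  cokernel.desc _ (N.map α ≫ Functor.whiskerLeft _ (cokernel.π (φ.app d))) (by
    rw [← Category.assoc, ← φ.naturality, Category.assoc, ← Functor.whiskerLeft_comp,
      cokernel.condition]
    ext; simp)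

theorem π_cokerMap (φ : M ⟶ N) {c d : C} (α : c ⟶ d) :
    cokernel.π (φ.app c) ≫ cokerMap φ α =
      N.map α ≫ Functor.whiskerLeft _ (cokernel.π (φ.app d)) :=
  cokernel.π_desc _ _ _

theorem π_app_cokerMap_app (φ : M ⟶ N) {c d : C} (α : c ⟶ d) (X : (P.obj c)ᵒᵖ) :
    (cokernel.π (φ.app c)).app X ≫ (cokerMap φ α).app X =
      (N.map α).app X ≫ (cokernel.π (φ.app d)).app ((P.map α).op.obj X) := by
  rw [← NatTrans.comp_app, π_cokerMap]
  rfl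

/-- The pointwise cokernel of a morphism of right modules. -/
noncomputable def coker (φ : M ⟶ N) : Mod.{w, t, v₁, u₁, u} P where
  obj c := cokernel (φ.app c)
  additive c := ⟨fun {X Y f g} => by
    -- Each axiom for the quotient reduces to the one for `N` by cancelling the epimorphic
    -- projection.
    rw [← cancel_epi ((cokernel.π (φ.app c)).app X), ← NatTrans.naturality, Functor.map_add,
      Preadditive.add_comp, Preadditive.comp_add, NatTrans.naturality, NatTrans.naturality]⟩
  map α := cokerMap φ α
  map_comp {c d e} α β γ h x := by
    rw [← cancel_epi ((cokernel.π (φ.app c)).app (Opposite.op x)), ← Category.assoc,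
      ← Category.assoc, π_app_cokerMap_app, π_app_cokerMap_app, Category.assoc, Category.assoc]
    refine (congrArg (fun ψ => (N.map γ).app (Opposite.op x) ≫ ψ)
      ((cokernel.π (φ.app e)).naturality ((P.μ α β γ h).hom.app x).op).symm).trans ?_
    refine Eq.trans ?_ (congrArg (fun ψ => (N.map α).app (Opposite.op x) ≫ ψ)
      (π_app_cokerMap_app φ β (Opposite.op ((P.map α).obj x))).symm)
    rw [← Category.assoc, N.map_comp, Category.assoc]
    rfl
  map_id c x := by
    rw [← cancel_epi ((cokernel.π (φ.app c)).app (Opposite.op x)), ← Category.assoc,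
      π_app_cokerMap_app, Category.assoc]
    refine (congrArg (fun ψ => (N.map (𝟙 c)).app (Opposite.op x) ≫ ψ)
      ((cokernel.π (φ.app c)).naturality ((P.δ c).hom.app x).op).symm).trans ?_
    rw [← Category.assoc, N.map_id, Category.id_comp, Category.comp_id]
    rfl

/-- The projection to the pointwise cokernel. -/
noncomputable def cokerπ (φ : M ⟶ N) : N ⟶ coker φ :=
  Hom.mk (fun c => cokernel.π (φ.app c)) (fun α => (π_cokerMap φ α).symm)

theorem comp_cokerπ (φ : M ⟶ N) : φ ≫ cokerπ φ = 0 :=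
  hom_ext fun c => cokernel.condition (φ.app c)

/-- As for `StrictMod.app_surjective`, the projection to the pointwise cokernel must be zero. -/
theorem epi_app (φ : M ⟶ N) [Epi φ] (c : C) : Epi (φ.app c) := by
  have h : cokerπ φ = 0 := (cancel_epi φ).1 (by rw [comp_cokerπ, Limits.comp_zero])
  exact Preadditive.epi_of_cokernel_zero (congrArg (fun ψ : N ⟶ coker φ => ψ.app c) h)

/-- A short complex of right modules that is pointwise short exact is short exact. -/
theorem shortExact_of_eval [HasZeroObject (Mod.{w, t, v₁, u₁, u} P)]
    {S : ShortComplex (Mod.{w, t, v₁, u₁, u} P)}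
    (h : ∀ c, (S.map (eval P c)).ShortExact) : S.ShortExact := by
  have hm : ∀ c, Mono (S.f.app c) := fun c => (h c).mono_f
  have he : ∀ c, Epi (S.g.app c) := fun c => (h c).epi_g
  -- Naturality of the pointwise lifts is an equation into a restricted functor, checked by
  -- cancelling this whiskered monomorphism.
  have hmw : ∀ {c d : C} (α : c ⟶ d), Mono (Functor.whiskerLeft (P.map α).op (S.f.app d)) :=
    fun {c d} α => by
      have : ∀ X, Mono ((Functor.whiskerLeft (P.map α).op (S.f.app d)).app X) := fun X =>
        inferInstanceAs (Mono ((S.f.app d).app _))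
      exact NatTrans.mono_of_mono_app _
  have hmf : Mono S.f := ⟨fun a b hab => hom_ext fun c =>
    (cancel_mono (S.f.app c)).1 (congrArg (fun ψ => Hom.app ψ c) hab)⟩
  have heg : Epi S.g := ⟨fun a b hab => hom_ext fun c =>
    (cancel_epi (S.g.app c)).1 (congrArg (fun ψ => Hom.app ψ c) hab)⟩
  have fac : ∀ {A : Mod.{w, t, v₁, u₁, u} P} (k : A ⟶ S.X₂) (hk : k ≫ S.g = 0) (c : C),
      ∃ l : A.obj c ⟶ S.X₁.obj c, l ≫ S.f.app c = k.app c := fun {A} k hk c =>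
    have := (h c).mono_f
    ⟨(h c).exact.lift (k.app c) (congrArg (fun ψ : A ⟶ S.X₃ => Hom.app ψ c) hk),
      (h c).exact.lift_f _ _⟩
  have cofac : ∀ {A : Mod.{w, t, v₁, u₁, u} P} (k : S.X₂ ⟶ A) (hk : S.f ≫ k = 0) (c : C),
      ∃ l : S.X₃.obj c ⟶ A.obj c, S.g.app c ≫ l = k.app c := fun {A} k hk c =>
    have := (h c).epi_g
    ⟨(h c).exact.desc (k.app c) (congrArg (fun ψ : S.X₁ ⟶ A => Hom.app ψ c) hk),
      (h c).exact.g_desc _ _⟩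
  choose l hl using @fac
  choose l' hl' using @cofac
  refine ShortComplex.shortExact_of_isLimit_of_isColimit
    (KernelFork.IsLimit.ofι' _ _ fun {A} k hk => ⟨Hom.mk (fun c => l k hk c) ?_, ?_⟩)
    (CokernelCofork.IsColimit.ofπ' _ _ fun {A} k hk => ⟨Hom.mk (fun c => l' k hk c) ?_, ?_⟩)
  · intro c d α
    rw [← cancel_mono (Functor.whiskerLeft (P.map α).op (S.f.app d)), Category.assoc,
      ← Functor.whiskerLeft_comp, hl, k.naturality, Category.assoc, S.f.naturality,
      ← Category.assoc, hl]
  · exact hom_ext fun c => hl k hk c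
  · intro c d α
    rw [← cancel_epi (S.g.app c), ← Category.assoc, ← S.g.naturality, Category.assoc,
      ← Functor.whiskerLeft_comp, hl', k.naturality, ← Category.assoc, hl']
  · exact hom_ext fun c => hl' k hk c

end Mod

end RepMod

/-! ### The corollary. -/

open RepMod in
theorem corollary4p16 {C : Type u₁} [Category.{v₁} C] (R : C ⥤ RingCat.{u})
    (S : ShortComplex (RepMod.StrictMod R)) (hS : S.ShortExact) :
    RepMod.StrictMod.PureExact S ↔ (S.map (RepMod.yoneda R)).ShortExact := by
  have hc := StrictMod.shortExact_eval hS
  have hpure : StrictMod.PureExact S ↔ ∀ (c : C) (F : FPMod (R.obj c)),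
      Function.Surjective fun h : F.obj ⟶ S.X₂.obj c => h ≫ S.g.app c :=
    forall_congr' fun c => pureExact_iff_surjective (hc c)
  rw [hpure]
  constructor
  · intro H
    -- Exactness of `S` supplies a zero object of `Mod-R`, which the additive functor `yoneda R`
    -- carries to one of `Mod-R_fp`.
    have h0 := hS.exact.hasZeroObject
    have : Limits.HasZeroObject (RepMod.Mod.{u + 1, u, v₁, u₁, u} (Rfp R)) :=
      ⟨⟨_, (yoneda R).map_isZero (Limits.isZero_zero _)⟩⟩
    refine Mod.shortExact_of_eval fun c => ShortComplex.shortExact_of_evaluation fun F => ?_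
    have := (hc c).mono_f
    refine ShortComplex.ShortExact.mk' ?_ ?_ ?_
    -- Exactness in the middle and injectivity are left exactness of `Hom(F, -)`; purity enters only
    -- in the last goal.
    · rw [ShortComplex.ab_exact_iff]
      intro (k : F.unop.obj ⟶ S.X₂.obj c) hk
      exact ⟨(hc c).exact.lift k hk, (hc c).exact.lift_f k hk⟩
    · rw [AddCommGrpCat.mono_iff_injective]
      exact fun a b hab => (cancel_mono (S.map (StrictMod.eval R c)).f).1 hab
    · rw [AddCommGrpCat.epi_iff_surjective]
      exact H c F.unop
  · intro H c F
    -- Only the epimorphism `Y(g)` is needed: it is epi at each `c`, and then at each `F`.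
    have := H.epi_g
    have := Mod.epi_app (S.map (yoneda R)).g c
    have h2 : Epi (((S.map (yoneda R)).g.app c).app (Opposite.op F)) := inferInstance
    exact (AddCommGrpCat.epi_iff_surjective _).1 h2
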